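/- Let $F_2$ be the free group of rank $2$, with the discrete topology and the coarse structure generated by the diagonals $\Delta_g=\{(h,hg)\mid h\in F_2\}$, where $g$ runs over the two free generators (equivalently, the bounded coarse structure of the left-invariant word metric). This is a coarsely connected proper coarse space. Let $C_h(F_2)$ be the unital $C^*$-algebra of bounded Higson functions on $F_2$, i.e. of bounded functions $f\colon F_2\to\mathbb{C}$ such that for every controlled set $E$ and every $\varepsilon>0$ there is a bounded set $B$ with $|f(y)-f(x)|<\varepsilon$ for all $(x,y)\in E\setminus B\times B$. Let $hF_2$ be the Higson compactification, i.e. the compact space of characters of $C_h(F_2)$, so that $C(hF_2)=C_h(F_2)$, and let $\nu F_2=hF_2\setminus F_2$ be the Higson corona. Let $F_2$ act on itself by left translation, $(g,h)\mapsto gh$. This action is a coarse action (for each $g\in F_2$ the map $h\mapsto gh$ is a coarse map, i.e. proper and bornologous), and the orbit of every point $h\in F_2$ is coarse (the orbit map $g\mapsto gh$ is a coarse map). Nevertheless the induced action of $F_2$ on $\nu F_2$ does not have any fixed point: there is no point $x\in\nu F_2$ such that $g\cdot x=x$ for every $g\in F_2$. -/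

import Mathlib

noncomputable section

open Set Filter Topology BoundedContinuousFunction

/-! ### Coarse spaces -/

/-- A coarse structure on `X` : a family of subsets of `X × X`, the controlled sets, which contains
the diagonal and is closed under subsets, inverses, compositions and finite unions. -/
class CoarseSpace (X : Type*) where
  IsControlled : Set (X × X) → Prop
  diag : IsControlled {p | p.1 = p.2}
  mono : ∀ {E F : Set (X × X)}, IsControlled F → E ⊆ F → IsControlled E
  inv : ∀ {E : Set (X × X)}, IsControlled E → IsControlled {p | (p.2, p.1) ∈ E}
  comp : ∀ {E F : Set (X × X)}, IsControlled E → IsControlled F →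
    IsControlled {p | ∃ y, (p.1, y) ∈ E ∧ (y, p.2) ∈ F}
  union : ∀ {E F : Set (X × X)}, IsControlled E → IsControlled F → IsControlled (E ∪ F)

namespace CoarseSpace

/-- Membership in the smallest coarse structure containing a given family `S` of subsets. -/
inductive GenerateControlled {X : Type*} (S : Set (Set (X × X))) : Set (X × X) → Prop
  | basic {E : Set (X × X)} : E ∈ S → GenerateControlled S E
  | diag : GenerateControlled S {p | p.1 = p.2}
  | mono {E F : Set (X × X)} : GenerateControlled S F → E ⊆ F → GenerateControlled S E
  | inv {E : Set (X × X)} : GenerateControlled S E → GenerateControlled S {p | (p.2, p.1) ∈ E}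
  | comp {E F : Set (X × X)} : GenerateControlled S E → GenerateControlled S F →
      GenerateControlled S {p | ∃ y, (p.1, y) ∈ E ∧ (y, p.2) ∈ F}
  | union {E F : Set (X × X)} : GenerateControlled S E → GenerateControlled S F →
      GenerateControlled S (E ∪ F)

/-- The coarse structure generated by a family of subsets of `X × X`. -/
@[reducible]
def generate {X : Type*} (S : Set (Set (X × X))) : CoarseSpace X where
  IsControlled := GenerateControlled S
  diag := .diag
  mono := .mono
  inv := .inv
  comp := .comp
  union := .union

/-- The coarse structure of a group (or monoid) `G` with generating set `S` : it is generated by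
the diagonals `Δ_g = {(h, h g) | h ∈ G}`, `g ∈ S`. -/
@[reducible]
def ofGenerators {G : Type*} [Monoid G] (S : Set G) : CoarseSpace G :=
  generate {E | ∃ g ∈ S, E = {p | p.2 = p.1 * g}}

end CoarseSpace

open CoarseSpace

/-- A subset `B` of a coarse space is bounded if `B × B` is controlled. -/
def IsCoarselyBounded {X : Type*} [CoarseSpace X] (B : Set X) : Prop :=
  IsControlled (B ×ˢ B)

/-- A coarse space is coarsely connected if every point of `X × X` lies in a controlled set. -/
class CoarselyConnected (X : Type*) [CoarseSpace X] : Prop where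
  exists_controlled : ∀ x y : X, ∃ E : Set (X × X), IsControlled E ∧ (x, y) ∈ E

/-- A (coarsely connected) proper coarse space: a paracompact Hausdorff space with a coarse
structure such that the diagonal has a controlled neighbourhood and bounded sets are relatively
compact. -/
class ProperCoarseSpace (X : Type*) [TopologicalSpace X] [CoarseSpace X] : Prop
    extends CoarselyConnected X, T2Space X, ParacompactSpace X where
  exists_controlled_nhds : ∃ U : Set (X × X), IsOpen U ∧ (∀ x, (x, x) ∈ U) ∧ IsControlled U
  isCompact_closure : ∀ B : Set X, IsCoarselyBounded B → IsCompact (closure B)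

/-- Bornologous maps: images of controlled sets are controlled. -/
def IsBornologous {X Y : Type*} [CoarseSpace X] [CoarseSpace Y] (f : X → Y) : Prop :=
  ∀ E : Set (X × X), IsControlled E → IsControlled (Prod.map f f '' E)

/-- (Coarsely) proper maps: inverse images of bounded sets are bounded. -/
def IsCoarselyProper {X Y : Type*} [CoarseSpace X] [CoarseSpace Y] (f : X → Y) : Prop :=
  ∀ B : Set Y, IsCoarselyBounded B → IsCoarselyBounded (f ⁻¹' B)

/-- Coarse maps: proper and bornologous. -/
def IsCoarseMap {X Y : Type*} [CoarseSpace X] [CoarseSpace Y] (f : X → Y) : Prop :=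
  IsCoarselyProper f ∧ IsBornologous f

/-- An action of `G` on a coarse space `X` is coarse if every `x ↦ g • x` is a coarse map. -/
class IsCoarseAction (G X : Type*) [Monoid G] [MulAction G X] [CoarseSpace X] : Prop where
  isCoarseMap_smul : ∀ g : G, IsCoarseMap (fun x : X => g • x)

/-- The orbit of `x₀` is coarse if the orbit map `g ↦ g • x₀` is a coarse map. -/
def IsCoarseOrbit (G : Type*) {X : Type*} [Monoid G] [MulAction G X] [CoarseSpace G]
    [CoarseSpace X] (x₀ : X) : Prop :=
  IsCoarseMap (fun g : G => g • x₀)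

theorem IsCoarselyBounded.union {X : Type*} [CoarseSpace X] [CoarselyConnected X] {A B : Set X}
    (hA : IsCoarselyBounded A) (hB : IsCoarselyBounded B) : IsCoarselyBounded (A ∪ B) := by
  rcases A.eq_empty_or_nonempty with rfl | ⟨a, ha⟩
  · simpa using hB
  rcases B.eq_empty_or_nonempty with rfl | ⟨b, hb⟩
  · simpa using hA
  obtain ⟨E, hE, hab⟩ := CoarselyConnected.exists_controlled a b
  have hAB := comp hA (comp hE hB)
  refine mono (CoarseSpace.union (CoarseSpace.union hA hB) (CoarseSpace.union hAB (inv hAB))) ?_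
  rintro ⟨x, y⟩ ⟨hx | hx, hy | hy⟩
  · exact .inl (.inl ⟨hx, hy⟩)
  · exact .inr (.inl ⟨a, ⟨hx, ha⟩, b, hab, hb, hy⟩)
  · exact .inr (.inr ⟨a, ⟨hy, ha⟩, b, hab, hb, hx⟩)
  · exact .inl (.inr ⟨hx, hy⟩)

theorem IsCoarselyBounded.empty {X : Type*} [CoarseSpace X] :
    IsCoarselyBounded (∅ : Set X) :=
  mono (diag (X := X)) (by simp)

/-! ### Higson functions -/

/-- `f` is a Higson function if for every controlled set `E` the function
`df (x, y) = f y - f x` vanishes at infinity on `E`. -/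
def IsHigson {X : Type*} [CoarseSpace X] (f : X → ℂ) : Prop :=
  ∀ E : Set (X × X), IsControlled E → ∀ ε : ℝ, 0 < ε →
    ∃ B : Set X, IsCoarselyBounded B ∧ ∀ p ∈ E \ B ×ˢ B, ‖f p.2 - f p.1‖ < ε

/-- The algebra `C_h(X)` of bounded continuous Higson functions. -/
def HigsonAlgebra (X : Type*) [TopologicalSpace X] [CoarseSpace X] [ProperCoarseSpace X] :
    StarSubalgebra ℂ (X →ᵇ ℂ) where
  carrier := {f | IsHigson f}
  algebraMap_mem' c E _ ε hε := ⟨∅, .empty, fun p _ => by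
    simpa [BoundedContinuousFunction.algebraMap_apply] using hε⟩
  add_mem' {f g} hf hg E hE ε hε := by
    obtain ⟨B, hB, h⟩ := hf E hE (ε / 2) (by positivity)
    obtain ⟨C, hC, h'⟩ := hg E hE (ε / 2) (by positivity)
    refine ⟨B ∪ C, hB.union hC, fun p hp => ?_⟩
    have h1 := h p ⟨hp.1, fun hb => hp.2 ⟨.inl hb.1, .inl hb.2⟩⟩
    have h2 := h' p ⟨hp.1, fun hb => hp.2 ⟨.inr hb.1, .inr hb.2⟩⟩
    have e : (f + g) p.2 - (f + g) p.1 = (f p.2 - f p.1) + (g p.2 - g p.1) := by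
      simp only [BoundedContinuousFunction.add_apply]; ring
    rw [e]
    exact (norm_add_le _ _).trans_lt (by linarith)
  mul_mem' {f g} hf hg E hE ε hε := by
    set M : ℝ := ‖f‖ + ‖g‖ + 1 with hM
    have hM0 : 0 < M := by positivity
    obtain ⟨B, hB, h⟩ := hf E hE (ε / (2 * M)) (by positivity)
    obtain ⟨C, hC, h'⟩ := hg E hE (ε / (2 * M)) (by positivity)
    refine ⟨B ∪ C, hB.union hC, fun p hp => ?_⟩
    have h1 := h p ⟨hp.1, fun hb => hp.2 ⟨.inl hb.1, .inl hb.2⟩⟩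
    have h2 := h' p ⟨hp.1, fun hb => hp.2 ⟨.inr hb.1, .inr hb.2⟩⟩
    have e : (f * g) p.2 - (f * g) p.1 = (f p.2 - f p.1) * g p.2 + f p.1 * (g p.2 - g p.1) := by
      simp only [BoundedContinuousFunction.mul_apply]; ring
    rw [e]
    have hf1 : ‖f p.1‖ ≤ M := (f.norm_coe_le_norm _).trans (by rw [hM]; linarith [norm_nonneg g])
    have hg1 : ‖g p.2‖ ≤ M := (g.norm_coe_le_norm _).trans (by rw [hM]; linarith [norm_nonneg f])
    have k1 : ‖f p.2 - f p.1‖ * ‖g p.2‖ ≤ ‖f p.2 - f p.1‖ * M := by gcongr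
    have k2 : ‖f p.1‖ * ‖g p.2 - g p.1‖ ≤ M * ‖g p.2 - g p.1‖ := by gcongr
    have k3 : ‖f p.2 - f p.1‖ * M < ε / (2 * M) * M := by gcongr
    have k4 : M * ‖g p.2 - g p.1‖ < M * (ε / (2 * M)) := by gcongr
    have k5 : ε / (2 * M) * M = ε / 2 := by field_simp
    calc _ ≤ _ := norm_add_le _ _
      _ < ε := by rw [norm_mul, norm_mul]; linarith
  star_mem' {f} hf E hE ε hε := by
    obtain ⟨B, hB, h⟩ := hf E hE ε hε
    refine ⟨B, hB, fun p hp => ?_⟩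
    have := h p hp
    rwa [BoundedContinuousFunction.star_apply, BoundedContinuousFunction.star_apply, ← star_sub,
      norm_star]

/-- `C_h(X)` is norm closed, hence a unital `C⋆`-algebra. -/
instance HigsonAlgebra.isClosed (X : Type*) [TopologicalSpace X] [CoarseSpace X]
    [ProperCoarseSpace X] : IsClosed (HigsonAlgebra X : Set (X →ᵇ ℂ)) := by
  refine isClosed_of_closure_subset fun f hf E hE ε hε => ?_
  obtain ⟨g, hg, hfg⟩ := Metric.mem_closure_iff.1 hf (ε / 3) (by positivity)
  obtain ⟨B, hB, h⟩ := hg E hE (ε / 3) (by positivity)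
  refine ⟨B, hB, fun p hp => ?_⟩
  have h0 := h p hp
  have h1 := (BoundedContinuousFunction.dist_coe_le_dist (f := f) (g := g) p.1).trans_lt hfg
  have h2 := (BoundedContinuousFunction.dist_coe_le_dist (f := f) (g := g) p.2).trans_lt hfg
  rw [dist_eq_norm] at h1 h2
  have e : f p.2 - f p.1 = (f p.2 - g p.2) + (g p.2 - g p.1) - (f p.1 - g p.1) := by ring
  rw [e]
  exact (norm_sub_le _ _).trans_lt (by linarith [norm_add_le (f p.2 - g p.2) (g p.2 - g p.1)])

instance (X : Type*) [TopologicalSpace X] [CoarseSpace X] [ProperCoarseSpace X] :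
    CommCStarAlgebra (HigsonAlgebra X) :=
  StarSubalgebra.commCStarAlgebra (HigsonAlgebra X)

/-- The pull-back `f ↦ f ∘ ψ` of Higson functions along a continuous coarse map `ψ`. -/
def HigsonAlgebra.pullback {X Y : Type*} [TopologicalSpace X] [CoarseSpace X]
    [ProperCoarseSpace X] [TopologicalSpace Y] [CoarseSpace Y] [ProperCoarseSpace Y]
    (ψ : C(X, Y)) (hψ : IsCoarseMap ψ) : HigsonAlgebra Y →⋆ₐ[ℂ] HigsonAlgebra X where
  toFun f := ⟨f.1.compContinuous ψ, fun E hE ε hε => by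
    obtain ⟨B, hB, h⟩ := f.2 _ (hψ.2 E hE) ε hε
    exact ⟨ψ ⁻¹' B, hψ.1 B hB, fun p hp => h (ψ p.1, ψ p.2) ⟨⟨p, hp.1, rfl⟩, hp.2⟩⟩⟩
  map_one' := rfl
  map_mul' _ _ := rfl
  map_zero' := rfl
  map_add' _ _ := rfl
  commutes' _ := rfl
  map_star' _ := rfl

/-! ### The Higson compactification and the Higson corona -/

/-- The Higson compactification `hX`: the compact space of characters of `C_h(X)`. -/
abbrev HigsonCompactification (X : Type*) [TopologicalSpace X] [CoarseSpace X]
    [ProperCoarseSpace X] : Type _ :=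
  WeakDual.characterSpace ℂ (HigsonAlgebra X)

/-- The canonical map `X → hX`, sending `x` to the evaluation `f ↦ f x`. -/
def HigsonCompactification.ofPoint {X : Type*} [TopologicalSpace X] [CoarseSpace X]
    [ProperCoarseSpace X] (x : X) : HigsonCompactification X :=
  WeakDual.CharacterSpace.equivAlgHom.symm
    { toFun := fun f => f.1 x
      map_one' := rfl
      map_mul' := fun _ _ => rfl
      map_zero' := rfl
      map_add' := fun _ _ => rfl
      commutes' := fun _ => rfl }

/-- The extension `hX → hY` of a continuous coarse map `ψ : X → Y`. -/
def HigsonCompactification.map {X Y : Type*} [TopologicalSpace X] [CoarseSpace X]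
    [ProperCoarseSpace X] [TopologicalSpace Y] [CoarseSpace Y] [ProperCoarseSpace Y]
    (ψ : C(X, Y)) (hψ : IsCoarseMap ψ) :
    C(HigsonCompactification X, HigsonCompactification Y) :=
  WeakDual.CharacterSpace.compContinuousMap (HigsonAlgebra.pullback ψ hψ)

/-- The Higson corona `νX = hX \ X`. -/
def HigsonCorona (X : Type*) [TopologicalSpace X] [CoarseSpace X] [ProperCoarseSpace X] :
    Type _ :=
  {φ : HigsonCompactification X // φ ∉ range (HigsonCompactification.ofPoint (X := X))}

instance (X : Type*) [TopologicalSpace X] [CoarseSpace X] [ProperCoarseSpace X] :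
    TopologicalSpace (HigsonCorona X) :=
  instTopologicalSpaceSubtype

section Action

variable {G X : Type*} [Group G] [MulAction G X] [TopologicalSpace X] [CoarseSpace X]
  [ProperCoarseSpace X] [ContinuousConstSMul G X] [IsCoarseAction G X]

/-- The continuous self-map of `hX` extending `x ↦ g • x`. -/
def HigsonCompactification.translate (g : G) :
    C(HigsonCompactification X, HigsonCompactification X) :=
  HigsonCompactification.map ⟨fun x => g • x, continuous_const_smul g⟩
    (IsCoarseAction.isCoarseMap_smul g)

theorem HigsonCompactification.translate_one (φ : HigsonCompactification X) :
    translate (1 : G) φ = φ := by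
  refine WeakDual.CharacterSpace.ext fun f => ?_
  change φ _ = φ f
  congr 1
  ext x
  exact congrArg f.1 (one_smul G x)

theorem HigsonCompactification.translate_mul (g h : G) (φ : HigsonCompactification X) :
    translate (g * h) φ = translate g (translate h φ) := by
  refine WeakDual.CharacterSpace.ext fun f => ?_
  change φ _ = φ _
  congr 1
  ext x
  exact congrArg f.1 (mul_smul g h x)

theorem HigsonCompactification.translate_ofPoint (g : G) (x : X) :
    translate g (ofPoint x) = ofPoint (g • x) :=
  WeakDual.CharacterSpace.ext fun _ => rfl

theorem HigsonCompactification.translate_notMem (g : G) {φ : HigsonCompactification X}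
    (hφ : φ ∉ range (ofPoint (X := X))) : translate g φ ∉ range (ofPoint (X := X)) := by
  rintro ⟨x, hx⟩
  refine hφ ⟨g⁻¹ • x, ?_⟩
  rw [← translate_ofPoint, hx, ← translate_mul, inv_mul_cancel, translate_one]

/-- The action of `G` on the Higson corona `νX` induced by a coarse action of `G` on `X` by
continuous maps: `g` acts as the restriction to `νX` of the extension of `x ↦ g • x` to `hX`. -/
instance HigsonCorona.instMulAction : MulAction G (HigsonCorona X) where
  smul g φ := ⟨HigsonCompactification.translate g φ.1,
    HigsonCompactification.translate_notMem g φ.2⟩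
  one_smul φ := Subtype.ext (HigsonCompactification.translate_one φ.1)
  mul_smul g h φ := Subtype.ext (HigsonCompactification.translate_mul g h φ.1)

end Action

/-! ### The free group of rank two as a proper coarse space -/

/-- The free group of rank two; it acts on itself by left translation, `g • h = g * h`. -/
abbrev F₂ : Type := FreeGroup (Fin 2)

instance : TopologicalSpace F₂ := ⊥

instance : DiscreteTopology F₂ := ⟨rfl⟩

instance : ContinuousConstSMul F₂ F₂ := ⟨fun _ => continuous_of_discreteTopology⟩

/-- The coarse structure of `F₂` generated by the diagonals of the two free generators. -/
instance : CoarseSpace F₂ := CoarseSpace.ofGenerators (range FreeGroup.of)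

/-- The controlled subsets of `F₂` are those with only finitely many differences `x⁻¹ y`. -/
theorem F₂.isControlled_iff (E : Set (F₂ × F₂)) :
    IsControlled E ↔ ((fun p : F₂ × F₂ => p.1⁻¹ * p.2) '' E).Finite := by
  constructor
  · intro h
    change GenerateControlled _ E at h
    induction h with
    | basic h =>
      obtain ⟨g, -, rfl⟩ := h
      refine (finite_singleton g).subset ?_
      rintro _ ⟨p, hp, rfl⟩
      simp only [mem_ofPred_eq] at hp
      simp [hp]
    | diag =>
      refine (finite_singleton 1).subset ?_
      rintro _ ⟨p, hp, rfl⟩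
      simp only [mem_ofPred_eq] at hp
      simp [hp]
    | mono _ h ih => exact ih.subset (image_mono h)
    | inv _ ih =>
      refine ih.inv.subset ?_
      rintro _ ⟨p, hp, rfl⟩
      exact ⟨_, hp, by simp⟩
    | comp _ _ ih ih' =>
      refine (ih.mul ih').subset ?_
      rintro _ ⟨p, ⟨y, h1, h2⟩, rfl⟩
      exact ⟨_, ⟨_, h1, rfl⟩, _, ⟨_, h2, rfl⟩, by simp [mul_assoc]⟩
    | union _ _ ih ih' => rw [image_union]; exact ih.union ih'
  · have key : ∀ g : F₂, IsControlled {p : F₂ × F₂ | p.1⁻¹ * p.2 = g} := by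
      intro g
      induction g using FreeGroup.induction_on with
      | C1 => exact mono diag fun p hp => by simpa [inv_mul_eq_one] using hp
      | of a =>
        exact GenerateControlled.basic ⟨_, ⟨a, rfl⟩, by ext p; simp [inv_mul_eq_iff_eq_mul]⟩
      | inv_of a ih =>
        refine mono (inv ih) fun p hp => ?_
        have := congrArg (·⁻¹) (show p.1⁻¹ * p.2 = _ from hp)
        simpa using this
      | mul x y ihx ihy =>
        refine mono (comp ihx ihy) fun p hp => ⟨p.1 * x, by simp, ?_⟩
        simp only [mem_ofPred_eq] at hp ⊢
        rw [mul_inv_rev, mul_assoc, hp, inv_mul_cancel_left]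
    intro h
    have hU : ∀ s : Set F₂, s.Finite → IsControlled {p : F₂ × F₂ | p.1⁻¹ * p.2 ∈ s} := by
      intro s hs
      induction s, hs using Set.Finite.induction_on with
      | empty => exact mono diag (by simp)
      | @insert a s _ _ ih =>
        refine mono (union (key a) ih) ?_
        rintro p (hp | hp)
        exacts [.inl hp, .inr hp]
    exact mono (hU _ h) fun p hp => ⟨p, hp, rfl⟩

/-- The bounded subsets of `F₂` are the finite ones. -/
theorem F₂.isCoarselyBounded_iff (B : Set F₂) : IsCoarselyBounded B ↔ B.Finite := by
  rw [IsCoarselyBounded, F₂.isControlled_iff]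
  constructor
  · intro h
    rcases B.eq_empty_or_nonempty with rfl | ⟨b, hb⟩
    · exact finite_empty
    refine Finite.of_finite_image (f := fun x => b⁻¹ * x) (h.subset ?_)
      (mul_right_injective _).injOn
    rintro _ ⟨x, hx, rfl⟩
    exact ⟨(b, x), ⟨hb, hx⟩, rfl⟩
  · exact fun h => (h.prod h).image _

instance : ProperCoarseSpace F₂ where
  exists_controlled x y :=
    ⟨{(x, y)}, (F₂.isControlled_iff _).2 ((finite_singleton _).image _), rfl⟩
  exists_controlled_nhds :=
    ⟨{p | p.1 = p.2}, isOpen_discrete _, fun _ => rfl, diag⟩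
  isCompact_closure B hB := by
    rw [closure_discrete]
    exact ((F₂.isCoarselyBounded_iff B).1 hB).isCompact

/-- Left translations of `F₂` are coarse maps, so `F₂` acts on `νF₂`. -/
instance : IsCoarseAction F₂ F₂ where
  isCoarseMap_smul g := by
    refine ⟨fun B hB => ?_, fun E hE => ?_⟩
    · rw [F₂.isCoarselyBounded_iff] at hB ⊢
      exact hB.preimage (MulAction.injective g).injOn
    · rw [F₂.isControlled_iff] at hE ⊢
      refine hE.subset ?_
      rintro _ ⟨_, ⟨p, hp, rfl⟩, rfl⟩
      exact ⟨p, hp, by simp [mul_assoc]⟩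

end

/-!
Let `W s` be the set of elements of the free group whose reduced word starts with the letter `s`
(`FreeGroup.startsWith s`). Right multiplication by a fixed element changes the first letter of
only finitely many reduced words (`finite_setOf_mul_right_mem_startsWith`), so the indicator
function of `W s` is a Higson function, `letterIndicator s`.

For a generator `a` with inverse letter `A`, left multiplication by `a` satisfies
`a * h ∈ W a ↔ h ∉ W A` (`of_mul_mem_startsWith_iff`). A character `φ` of `C_h(F₂)` that is fixed
by `a` therefore takes the same value on `1_{W a}` and on `1 - 1_{W A}`, that is,
`φ(1_{W a} + 1_{W A}) = 1`. If `φ` is fixed by both generators `a` and `b`, then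
`φ((1_{W a} + 1_{W A}) (1_{W b} + 1_{W B})) = 1`, although the product vanishes because the four
sets are pairwise disjoint. So `F₂` has no fixed point on all of `hF₂`, in particular none on the
corona.
-/

open Set

namespace FreeGroup

variable {α : Type*} [DecidableEq α]

/-- Appending a letter to a reduced word of length at least two cancels at most the last letter,
so it does not affect the first one. -/
theorem IsReduced.reduce_append_singleton_getElem?_zero (s : α × Bool) :
    ∀ {L : List (α × Bool)}, IsReduced L → 2 ≤ L.length → (reduce (L ++ [s]))[0]? = L[0]?
  | [], _, h | [_], _, h => by simp at h
  | [a, b], hL, _ => by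
    have := (isReduced_cons_cons.1 hL).1
    simp only [List.cons_append, List.nil_append, reduce.cons, reduce_nil]
    by_cases hbs : b.1 = s.1 ∧ b.2 = !s.2
    · simp [hbs]
    · simp only [hbs, if_false]
      grind
  | a :: b :: c :: L, hL, _ => by
    obtain ⟨hab, hL⟩ := isReduced_cons_cons.1 hL
    have ih := hL.reduce_append_singleton_getElem?_zero s (by simp)
    rw [List.cons_append, reduce.cons]
    cases h : reduce (b :: c :: L ++ [s]) with
    | nil => simp
    | cons d M =>
      rw [h] at ih
      grind

theorem finite_setOf_mul_right_mem_startsWith [Finite α] (s : α × Bool) (d : FreeGroup α) :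
    {x : FreeGroup α | ¬ (x * d ∈ startsWith s ↔ x ∈ startsWith s)}.Finite := by
  have letter (t : α × Bool) :
      {x : FreeGroup α | ¬ (x * mk [t] ∈ startsWith s ↔ x ∈ startsWith s)}.Finite := by
    refine ((List.finite_length_lt (α × Bool) 2).preimage toWord_injective.injOn).subset ?_
    intro x hx
    by_contra hlen
    refine hx ?_
    have := isReduced_toWord.reduce_append_singleton_getElem?_zero (L := x.toWord) t
      (by simpa [Nat.succ_le_iff] using hlen)
    simp only [startsWith, mem_ofPred_eq, toWord_mul, toWord_mk, reduce_singleton, this]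
  induction d using FreeGroup.induction_on with
  | C1 => simp
  | of a => exact letter (a, true)
  | inv_of a _ => exact letter (a, false)
  | mul d e hd he =>
    refine (hd.union (he.preimage (mul_left_injective d).injOn)).subset fun x hx => ?_
    simp only [mem_union, mem_preimage, mem_ofPred_eq, mul_assoc] at hx ⊢
    tauto

theorem of_mul_mem_startsWith_iff (a : α) (x : FreeGroup α) :
    of a * x ∈ startsWith (a, true) ↔ x ∉ startsWith (a, false) := by
  refine ⟨fun h hx => ?_, startsWith_mk_mul (w := (a, true)) x⟩
  have hred : IsReduced x.toWord := isReduced_toWord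
  have hw : (of a * x).toWord = reduce ((a, true) :: x.toWord) := by
    rw [toWord_mul, toWord_of, List.singleton_append]
  simp only [startsWith, mem_ofPred_eq, hw, reduce.cons, reduce_toWord] at h hx
  match hL : x.toWord with
  | [] => simp [hL] at hx
  | b :: L =>
    obtain rfl : b = (a, false) := by simpa [hL] using hx
    replace h : L[0]? = some (a, true) := by simpa [hL] using h
    cases L with
    | nil => simp at h
    | cons c L =>
      obtain rfl : c = (a, true) := by simpa using h
      rw [hL, isReduced_cons_cons] at hred
      simpa using hred.1 rfl

end FreeGroup

/-- A set with finite symmetric difference to each of its right translates has a Higson indicator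
function. -/
theorem F₂.isHigson_indicator {W : Set F₂} (hW : ∀ d, {x | ¬ (x * d ∈ W ↔ x ∈ W)}.Finite) :
    IsHigson (W.indicator (1 : F₂ → ℂ)) := by
  intro E hE ε hε
  rw [F₂.isControlled_iff] at hE
  -- A pair in `E` on which the indicator is not constant has both entries in `B`.
  let B : Set F₂ := ⋃ d ∈ (fun p : F₂ × F₂ => p.1⁻¹ * p.2) '' E,
    {x | ¬ (x * d ∈ W ↔ x ∈ W)} ∪ (· * d) '' {x | ¬ (x * d ∈ W ↔ x ∈ W)}
  refine ⟨B, (F₂.isCoarselyBounded_iff B).2 ?_, fun p hp => ?_⟩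
  · exact hE.biUnion fun d _ => (hW d).union ((hW d).image _)
  · have hmem : p.2 ∈ W ↔ p.1 ∈ W := by
      by_contra hne
      have hne' : ¬ (p.1 * (p.1⁻¹ * p.2) ∈ W ↔ p.1 ∈ W) := by rwa [mul_inv_cancel_left]
      have hd := mem_image_of_mem (fun p : F₂ × F₂ => p.1⁻¹ * p.2) hp.1
      exact hp.2 ⟨mem_biUnion hd (.inl hne'),
        mem_biUnion hd (.inr ⟨p.1, hne', mul_inv_cancel_left _ _⟩)⟩
    have heq : W.indicator (1 : F₂ → ℂ) p.2 = W.indicator 1 p.1 := by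
      by_cases h : p.1 ∈ W
      · rw [indicator_of_mem h, indicator_of_mem (hmem.2 h), Pi.one_apply, Pi.one_apply]
      · rw [indicator_of_notMem h, indicator_of_notMem (mt hmem.1 h)]
    rwa [heq, sub_self, norm_zero]

/-- The indicator function of the set of elements of `F₂` whose reduced word starts with the letter
`s`, as an element of `C_h(F₂)`. -/
noncomputable def letterIndicator (s : Fin 2 × Bool) : HigsonAlgebra F₂ :=
  ⟨BoundedContinuousFunction.ofNormedAddCommGroupDiscrete ((FreeGroup.startsWith s).indicator 1) 1
    fun x => by by_cases hx : x ∈ FreeGroup.startsWith s <;> simp [hx],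
    F₂.isHigson_indicator (FreeGroup.finite_setOf_mul_right_mem_startsWith s)⟩

theorem letterIndicator_apply (s : Fin 2 × Bool) (x : F₂) :
    (letterIndicator s).1 x = (FreeGroup.startsWith s).indicator 1 x :=
  rfl

theorem letterIndicator_mul_of_ne {s t : Fin 2 × Bool} (hst : s ≠ t) :
    letterIndicator s * letterIndicator t = 0 := by
  refine Subtype.ext (BoundedContinuousFunction.ext fun x => ?_)
  change (letterIndicator s).1 x * (letterIndicator t).1 x = 0
  simp only [letterIndicator_apply]
  by_cases hs : x ∈ FreeGroup.startsWith s
  · have ht := (FreeGroup.startsWith.disjoint_iff_ne.2 hst).notMem_of_mem_left hs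
    simp [ht]
  · simp [hs]

theorem pullback_letterIndicator (i : Fin 2) :
    HigsonAlgebra.pullback ⟨fun x : F₂ => FreeGroup.of i • x, continuous_const_smul _⟩
      (IsCoarseAction.isCoarseMap_smul (FreeGroup.of i)) (letterIndicator (i, true)) =
      1 - letterIndicator (i, false) := by
  refine Subtype.ext (BoundedContinuousFunction.ext fun x => ?_)
  change (letterIndicator (i, true)).1 (FreeGroup.of i * x) =
    1 - (letterIndicator (i, false)).1 x
  simp only [letterIndicator_apply]
  have := FreeGroup.of_mul_mem_startsWith_iff i x
  by_cases hx : x ∈ FreeGroup.startsWith (i, false) <;> simp [indicator, this, hx]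

theorem HigsonCompactification.apply_letterIndicator_add_of_fixed {φ : HigsonCompactification F₂}
    {i : Fin 2} (hφ : translate (FreeGroup.of i) φ = φ) :
    φ (letterIndicator (i, true)) + φ (letterIndicator (i, false)) = 1 := by
  have h : φ (1 - letterIndicator (i, false)) = φ (letterIndicator (i, true)) := by
    rw [← pullback_letterIndicator]
    exact congrArg (fun ψ : HigsonCompactification F₂ => ψ (letterIndicator (i, true))) hφ
  rw [← h, map_sub, map_one, sub_add_cancel]

theorem HigsonCompactification.not_forall_translate_eq (φ : HigsonCompactification F₂) :
    ¬ ∀ g : F₂, translate g φ = φ := by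
  intro hφ
  have h0 := apply_letterIndicator_add_of_fixed (hφ (FreeGroup.of 0))
  have h1 := apply_letterIndicator_add_of_fixed (hφ (FreeGroup.of 1))
  have hmul (b c : Bool) : φ (letterIndicator (0, b)) * φ (letterIndicator (1, c)) = 0 := by
    rw [← map_mul, letterIndicator_mul_of_ne (by simp), map_zero]
  refine one_ne_zero (α := ℂ) ?_
  calc (1 : ℂ) = (φ (letterIndicator (0, true)) + φ (letterIndicator (0, false))) *
        (φ (letterIndicator (1, true)) + φ (letterIndicator (1, false))) := by rw [h0, h1, one_mul]
    _ = 0 := by simp only [add_mul, mul_add, hmul, add_zero]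

theorem F₂.isCoarseOrbit (h : F₂) : IsCoarseOrbit F₂ h := by
  refine ⟨fun B hB => ?_, fun E hE => ?_⟩
  · rw [F₂.isCoarselyBounded_iff] at hB ⊢
    exact hB.preimage (mul_left_injective h).injOn
  · rw [F₂.isControlled_iff] at hE ⊢
    refine (hE.image fun d => h⁻¹ * d * h).subset ?_
    rintro _ ⟨_, ⟨p, hp, rfl⟩, rfl⟩
    exact ⟨_, mem_image_of_mem _ hp, by simp [mul_assoc]⟩

theorem mainTheorem4 :
    (IsCoarseAction F₂ F₂ ∧ ∀ h : F₂, IsCoarseOrbit F₂ h) ∧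
      ¬ ∃ x : HigsonCorona F₂, ∀ g : F₂, g • x = x :=
  ⟨⟨inferInstance, F₂.isCoarseOrbit⟩, fun ⟨x, hx⟩ =>
    HigsonCompactification.not_forall_translate_eq x.1 fun g => congrArg Subtype.val (hx g)⟩
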